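/- Let $f\in\mathbb{C}[x_1,\dots,x_n]$ be a homogeneous polynomial of degree $d\ge 1$. Its Waring rank $\mathrm{WR}(f)$ is the smallest number $s$ such that $f=\sum_{i=1}^{s}\ell_i^{\,d}$ for some homogeneous linear forms $\ell_1,\dots,\ell_s\in\mathbb{C}[x_1,\dots,x_n]$, and its border Waring rank $\underline{\mathrm{WR}}(f)$ is the smallest number $r$ such that $f$ is the limit of a sequence of homogeneous polynomials of degree $d$ in $\mathbb{C}[x_1,\dots,x_n]$ of Waring rank at most $r$. If $\underline{\mathrm{WR}}(f)=r$, then $$\mathrm{WR}(f)\le\binom{2r-2}{r-1}\cdot d,$$ and in particular $\mathrm{WR}(f)\le 4^r\cdot d$. (For $f=0$, that is $r=0$, the binomial coefficient is read as $1$.) -/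

import Mathlib

open MvPolynomial Filter Topology

/-- `f` is a sum of `r` many `d`-th powers of homogeneous linear forms in `x_1, …, x_n`. -/
def HasWaringDecomposition {n : ℕ} (d r : ℕ) (f : MvPolynomial (Fin n) ℂ) : Prop :=
  ∃ ℓ : Fin r → MvPolynomial (Fin n) ℂ, (∀ k, (ℓ k).IsHomogeneous 1) ∧ f = ∑ k, ℓ k ^ d

/-- The Waring rank of `f` as a form of degree `d`: the smallest number of summands in a Waring
rank decomposition (and `⊤` if there is none). -/
noncomputable def waringRank {n : ℕ} (d : ℕ) (f : MvPolynomial (Fin n) ℂ) : ℕ∞ :=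
  ⨅ (r : ℕ) (_ : HasWaringDecomposition d r f), (r : ℕ∞)

/-- `f` is the limit of a sequence of forms of degree `d` of Waring rank at most `r`. Forms of a
fixed degree in finitely many variables are a finite-dimensional space, where convergence is
convergence of all coefficients. -/
def IsWaringLimit {n : ℕ} (d r : ℕ) (f : MvPolynomial (Fin n) ℂ) : Prop :=
  ∃ g : ℕ → MvPolynomial (Fin n) ℂ,
    (∀ i, (g i).IsHomogeneous d ∧ waringRank d (g i) ≤ (r : ℕ∞)) ∧
    ∀ m : Fin n →₀ ℕ, Tendsto (fun i => coeff m (g i)) atTop (𝓝 (coeff m f))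

/-- The border Waring rank of `f` as a form of degree `d`: the smallest `r` such that `f` is a
limit of a sequence of forms of Waring rank at most `r`. -/
noncomputable def borderWaringRank {n : ℕ} (d : ℕ) (f : MvPolynomial (Fin n) ℂ) : ℕ∞ :=
  ⨅ (r : ℕ) (_ : IsWaringLimit d r f), (r : ℕ∞)

/-!
Waring decompositions are studied on the dual side. The apolarity pairing turns a form `f` of degree
`d` into a functional `φ` on forms of degree `d`, in such a way that the power `ℓ ^ d` of a linear
form becomes the evaluation at the point `ℓ`. Hence the Waring rank is the least number of
evaluations of which `φ` is a linear combination (`IsEvalCombination`), and a border decomposition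
exhibits `φ` as a limit of sums of `r` evaluations. Forms are treated as functions on a vector
space `V`: those of degree `d` are the `d`-th power of the subspace of linear forms in the algebra of
all functions.

*Few variables.* The catalecticant of `φ`, pairing linear forms with forms of degree `d - 1`, is a
limit of maps of rank at most `r`. So `φ` only sees the restriction of a form to a subspace of
dimension at most `r`, and one may assume `dim V ≤ r` (`isEvalCombination_of_tendsto`).

*Small degree.* Evaluations span the dual of a finite-dimensional space of functions, so as many of
them suffice as the dimension. For `d < r` the dimension of the space of forms is already at most
`(2r-2).choose (r-1)`.

*Large degree.* For `d ≥ r`, scale the points of the evaluations to the unit sphere and pass to a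
limit `v₁, …, vᵣ` of a subsequence. A product of linear forms `L₁ ⋯ Lᵣ` with `Lₖ` vanishing at `vₖ`
is a limit of products vanishing at the approximating points, so `φ` kills all multiples of such
products of degree `d` (`pointProduct_le_ker_of_tendsto`). No limit scheme is needed. Now remove the
points one at a time (`exists_sub_le_ker`): if `v` occurs `a` more times among the remaining points,
then, modulo forms killed by `φ`, the forms of degree `d` in the product for the remaining points are
multiples of one fixed form by products `α` of `a` linear forms vanishing at `v`. On these products,
`φ` is a combination of evaluations `α ↦ α w`, and each of these is induced by the functional taking
`p` to the coefficient of `t ^ a` in `p (v + t w)`, which is a combination of `d` evaluations at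
points `v + ζ w` with `ζ ^ d = 1`, as `a < d` (`exists_coefficient_functional`). The difference
kills the product for the remaining points. The number of evaluations is `d` times the sum of the
dimensions of the spaces of forms of degree `0, …, r - 1` in `r - 1` variables, that is
`(2r-2).choose (r-1) * d`.
-/

/-! ### Functionals that are combinations of few point evaluations -/

/-- On the space `A` of functions on `X`, the functional `φ` is a linear combination of `B`
evaluations at points of `X` (points may repeat and coefficients may vanish, so that this is
monotone in `B` when `X` is nonempty). -/
def IsEvalCombination {X : Type*} (A : Submodule ℂ (X → ℂ)) (B : ℕ)
    (φ : (X → ℂ) →ₗ[ℂ] ℂ) : Prop :=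
  ∃ (c : Fin B → ℂ) (w : Fin B → X), ∀ p ∈ A, φ p = ∑ j, c j * p (w j)

namespace IsEvalCombination

variable {X : Type*} {A : Submodule ℂ (X → ℂ)} {φ ψ : (X → ℂ) →ₗ[ℂ] ℂ}

lemma of_fintype {ι : Type*} [Fintype ι] (c : ι → ℂ) (w : ι → X)
    (h : ∀ p ∈ A, φ p = ∑ j, c j * p (w j)) : IsEvalCombination A (Fintype.card ι) φ := by
  let e := (Fintype.equivFin ι).symm
  exact ⟨c ∘ e, w ∘ e, fun p hp => by
    rw [h p hp]; exact (e.sum_comp fun j => c j * p (w j)).symm⟩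

lemma add {a b : ℕ} (hφ : IsEvalCombination A a φ) (hψ : IsEvalCombination A b ψ) :
    IsEvalCombination A (a + b) (φ + ψ) := by
  obtain ⟨c, w, h⟩ := hφ
  obtain ⟨c', w', h'⟩ := hψ
  have := of_fintype (A := A) (φ := φ + ψ) (Sum.elim c c') (Sum.elim w w') fun p hp => by
    simp [h p hp, h' p hp]
  simpa using this

lemma zero_of_le_ker (h : A ≤ LinearMap.ker φ) : IsEvalCombination A 0 φ :=
  ⟨Fin.elim0, Fin.elim0, fun p hp => by simpa using h hp⟩

lemma mono [Nonempty X] {a b : ℕ} (hab : a ≤ b) (hφ : IsEvalCombination A a φ) :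
    IsEvalCombination A b φ := by
  have h0 : IsEvalCombination A (b - a) 0 :=
    ⟨0, fun _ => Classical.arbitrary X, fun p _ => by simp⟩
  simpa [Nat.add_sub_cancel' hab] using hφ.add h0

lemma sum_smul {m b : ℕ} (c : Fin m → ℂ) (u : Fin m → (X → ℂ) →ₗ[ℂ] ℂ)
    (h : ∀ i, IsEvalCombination A b (u i)) : IsEvalCombination A (m * b) (∑ i, c i • u i) := by
  choose c' w hw using h
  have := of_fintype (A := A) (φ := ∑ i, c i • u i) (ι := Fin m × Fin b)
    (fun x => c x.1 * c' x.1 x.2) (fun x => w x.1 x.2) fun p hp => by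
    simp only [LinearMap.sum_apply, LinearMap.smul_apply, Fintype.sum_prod_type, smul_eq_mul]
    refine Finset.sum_congr rfl fun i _ => ?_
    rw [hw i p hp, Finset.mul_sum]
    exact Finset.sum_congr rfl fun j _ => (mul_assoc _ _ _).symm
  simpa using this

/-- The evaluations separate the elements of `A`, hence span its dual, so a basis of the dual can
be chosen among them. -/
lemma of_finrank [FiniteDimensional ℂ A] (φ : (X → ℂ) →ₗ[ℂ] ℂ) :
    IsEvalCombination A (Module.finrank ℂ A) φ := by
  let ev : X → Module.Dual ℂ A := fun x => (LinearMap.proj x : (X → ℂ) →ₗ[ℂ] ℂ).domRestrict A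
  have hspan : Submodule.span ℂ (Set.range ev) = ⊤ := by
    refine Submodule.span_eq_top_of_ne_zero (R := ℂ) (M := A) fun a ha => ?_
    obtain ⟨x, hx⟩ : ∃ x, (a : X → ℂ) x ≠ 0 := by
      by_contra! h
      exact ha (Subtype.ext (funext h))
    exact ⟨ev x, ⟨x, rfl⟩, hx⟩
  obtain ⟨f, hf, hfs, -⟩ := Submodule.exists_fun_fin_finrank_span_eq ℂ (Set.range ev)
  choose w hw using hf
  have hmem : φ.domRestrict A ∈ Submodule.span ℂ (Set.range f) := by
    rw [hfs, hspan]; trivial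
  obtain ⟨c, hc⟩ := (Submodule.mem_span_range_iff_exists_fun ℂ).1 hmem
  have := of_fintype (A := A) (φ := φ) c w fun p hp => by
    have := LinearMap.congr_fun hc ⟨p, hp⟩
    rw [LinearMap.domRestrict_apply] at this
    rw [← this, LinearMap.sum_apply]
    refine Finset.sum_congr rfl fun j _ => ?_
    rw [← hw j]; rfl
  rwa [hspan, finrank_top, Subspace.dual_finrank_eq, Fintype.card_fin] at this

end IsEvalCombination

/-! ### Powers of a finite-dimensional space of functions -/

lemma Submodule.pow_le_span_sym {R A ι : Type*} [CommSemiring R] [CommSemiring A] [Algebra R A]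
    [Fintype ι] (b : ι → A) (a : ℕ) :
    Submodule.span R (Set.range b) ^ a ≤
      Submodule.span R (Set.range fun s : Sym ι a => ((s : Multiset ι).map b).prod) := by
  rw [Submodule.span_pow]
  refine Submodule.span_mono fun x hx => ?_
  rw [Set.mem_pow] at hx
  obtain ⟨f, rfl⟩ := hx
  choose g hg using fun i => (f i).2
  refine ⟨⟨(List.ofFn g : Multiset ι), by simp⟩, ?_⟩
  simp only [Sym.coe_mk, Multiset.map_coe, Multiset.prod_coe, List.map_ofFn]
  congr 2
  ext i
  exact hg i

lemma Submodule.finrank_pow_le {A : Type*} [CommRing A] [Algebra ℂ A]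
    (P : Submodule ℂ A) [FiniteDimensional ℂ P] (a : ℕ) :
    FiniteDimensional ℂ ↥(P ^ a) ∧
      Module.finrank ℂ ↥(P ^ a) ≤ (Module.finrank ℂ P).multichoose a := by
  classical
  let b := Module.finBasis ℂ P
  have hb : Submodule.span ℂ (Set.range fun i => (b i : A)) = P := by
    have := congrArg (Submodule.map P.subtype) b.span_eq
    rw [Submodule.map_span, Submodule.map_top, Submodule.range_subtype, ← Set.range_comp] at this
    exact this
  have hle := Submodule.pow_le_span_sym (R := ℂ) (fun i => (b i : A)) a
  rw [hb] at hle
  have := FiniteDimensional.span_of_finite ℂ (Set.finite_range fun s :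
    Sym (Fin (Module.finrank ℂ P)) a => ((s : Multiset _).map fun i => (b i : A)).prod)
  refine ⟨Submodule.finiteDimensional_of_le hle, (Submodule.finrank_mono hle).trans ?_⟩
  refine (finrank_range_le_card _).trans ?_
  rw [Sym.card_sym_eq_multichoose, Fintype.card_fin]

/-! ### Forms as functions on a vector space -/

/-- The linear forms on `V`, as a subspace of the algebra of functions on `V`. Its power
`linearForms V ^ d` in that algebra is the space of forms of degree `d` on `V`. -/
def linearForms (V : Type*) [AddCommGroup V] [Module ℂ V] : Submodule ℂ (V → ℂ) :=
  LinearMap.range (LinearMap.ltoFun ℂ V ℂ ℂ)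

/-- The linear forms that vanish at the point `v`. -/
def linearFormsAt {V : Type*} [AddCommGroup V] [Module ℂ V] (v : V) : Submodule ℂ (V → ℂ) :=
  linearForms V ⊓ LinearMap.ker (LinearMap.proj v)

section

variable {V : Type*} [AddCommGroup V] [Module ℂ V]

lemma mem_linearForms {p : V → ℂ} : p ∈ linearForms V ↔ ∃ l : V →ₗ[ℂ] ℂ, ⇑l = p := Iff.rfl

lemma mem_linearFormsAt {v : V} {p : V → ℂ} :
    p ∈ linearFormsAt v ↔ p ∈ linearForms V ∧ p v = 0 := by
  simp [linearFormsAt]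

lemma linearFormsAt_le (v : V) : linearFormsAt v ≤ linearForms V := inf_le_left

instance [FiniteDimensional ℂ V] : FiniteDimensional ℂ (linearForms V) := by
  unfold linearForms; infer_instance

lemma finrank_linearForms [FiniteDimensional ℂ V] :
    Module.finrank ℂ (linearForms V) = Module.finrank ℂ V := by
  rw [linearForms, LinearMap.finrank_range_of_inj (f := LinearMap.ltoFun ℂ V ℂ ℂ)
    DFunLike.coe_injective]
  exact Subspace.dual_finrank_eq

instance [FiniteDimensional ℂ V] (v : V) : FiniteDimensional ℂ (linearFormsAt v) :=
  Submodule.finiteDimensional_of_le (linearFormsAt_le v)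

lemma exists_mem_linearForms_eq_one {v : V} (hv : v ≠ 0) : ∃ y ∈ linearForms V, y v = 1 := by
  obtain ⟨l, hl⟩ := Submodule.exists_le_ker_of_notMem (p := (⊥ : Submodule ℂ V)) (v := v)
    (by simpa using hv)
  refine ⟨(l v)⁻¹ • ⇑l, Submodule.smul_mem _ _ ⟨l, rfl⟩, ?_⟩
  simp [hl.1]

lemma exists_mem_linearFormsAt_eq_one {v w : V} (h : v ∉ Submodule.span ℂ {w}) :
    ∃ y ∈ linearFormsAt w, y v = 1 := by
  obtain ⟨l, hl, hw⟩ := Submodule.exists_le_ker_of_notMem h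
  refine ⟨(l v)⁻¹ • ⇑l, Submodule.smul_mem _ _ (mem_linearFormsAt.2 ⟨⟨l, rfl⟩, ?_⟩), ?_⟩
  · exact hw (Submodule.mem_span_singleton_self w)
  · simp [hl]

lemma linearFormsAt_eq_of_mem_span {v w : V} (hv : v ≠ 0) (h : v ∈ Submodule.span ℂ {w}) :
    linearFormsAt w = linearFormsAt v := by
  obtain ⟨c, rfl⟩ := Submodule.mem_span_singleton.1 h
  have hc : c ≠ 0 := by rintro rfl; simp at hv
  ext p
  simp only [mem_linearFormsAt]
  refine and_congr_right fun ⟨l, hl⟩ => ?_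
  subst hl
  simp [hc]

lemma finrank_linearFormsAt_lt [FiniteDimensional ℂ V] {v : V} (hv : v ≠ 0) :
    Module.finrank ℂ (linearFormsAt v) < Module.finrank ℂ V := by
  rw [← finrank_linearForms (V := V)]
  refine Submodule.finrank_lt_finrank_of_lt (lt_of_le_of_ne (linearFormsAt_le v) fun h => ?_)
  obtain ⟨y, hy, hy1⟩ := exists_mem_linearForms_eq_one hv
  rw [← h] at hy
  simp [(mem_linearFormsAt.1 hy).2] at hy1

lemma sub_mem_linearFormsAt {v : V} {y p : V → ℂ} (hy : y ∈ linearForms V) (hy1 : y v = 1)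
    (hp : p ∈ linearForms V) : p - p v • y ∈ linearFormsAt v :=
  mem_linearFormsAt.2 ⟨sub_mem hp (Submodule.smul_mem _ _ hy), by simp [hy1]⟩

/-- Products of `a` linear forms vanishing at `v` are homogeneous of degree `a` in the
displacement from `v`. -/
lemma apply_add_smul_of_mem_pow {v : V} {a : ℕ} {p : V → ℂ} (hp : p ∈ linearFormsAt v ^ a)
    (t : ℂ) (w : V) : p (v + t • w) = t ^ a * p w := by
  induction a generalizing p with
  | zero =>
    rw [pow_zero, Submodule.mem_one] at hp
    obtain ⟨c, rfl⟩ := hp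
    simp [Pi.algebraMap_apply]
  | succ a ih =>
    rw [pow_succ] at hp
    induction hp using Submodule.mul_induction_on' with
    | mem_mul_mem m hm n hn =>
      obtain ⟨hn', hl⟩ := mem_linearFormsAt.1 hn
      obtain ⟨l, rfl⟩ := mem_linearForms.1 hn'
      simp only [Pi.mul_apply, ih hm, map_add, map_smul, hl, smul_eq_mul]
      ring
    | add x _ y _ hx hy => simp only [Pi.add_apply, hx, hy]; ring

/-- Along a line through `v`, a form of degree `b` is a polynomial of degree at most `b` in the
parameter. -/
lemma exists_polynomial_of_mem_pow {b : ℕ} {p : V → ℂ} (hp : p ∈ linearForms V ^ b) (v w : V) :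
    ∃ P : Polynomial ℂ, P.natDegree ≤ b ∧ ∀ t : ℂ, p (v + t • w) = P.eval t := by
  induction b generalizing p with
  | zero =>
    rw [pow_zero, Submodule.mem_one] at hp
    obtain ⟨c, rfl⟩ := hp
    exact ⟨Polynomial.C c, by simp, by simp [Pi.algebraMap_apply]⟩
  | succ b ih =>
    rw [pow_succ] at hp
    induction hp using Submodule.mul_induction_on' with
    | mem_mul_mem m hm n hn =>
      obtain ⟨l, rfl⟩ := mem_linearForms.1 hn
      obtain ⟨P, hP, hPe⟩ := ih hm
      refine ⟨P * (Polynomial.C (l v) + Polynomial.C (l w) * Polynomial.X), ?_, fun t => ?_⟩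
      · refine Polynomial.natDegree_mul_le.trans (add_le_add hP ?_)
        compute_degree
      · simp only [Pi.mul_apply, hPe, map_add, map_smul, smul_eq_mul, Polynomial.eval_mul,
          Polynomial.eval_add, Polynomial.eval_C, Polynomial.eval_X]
        ring
    | add x _ y _ hx hy =>
      obtain ⟨P, hP, hPe⟩ := hx
      obtain ⟨Q, hQ, hQe⟩ := hy
      exact ⟨P + Q, (Polynomial.natDegree_add_le _ _).trans (max_le hP hQ), by simp [hPe, hQe]⟩

/-- Averaging a polynomial of degree less than `d` over the `d`-th roots of unity yields its
value at `0`. -/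
lemma sum_eval_pow_primitiveRoot {d : ℕ} {ζ : ℂ} (hζ : IsPrimitiveRoot ζ d) {P : Polynomial ℂ}
    (hP : P.natDegree < d) : ∑ k : Fin d, P.eval (ζ ^ (k : ℕ)) = d * P.eval 0 := by
  simp_rw [Polynomial.eval_eq_sum_range' hP]
  rw [Finset.sum_comm, Finset.sum_eq_single 0]
  · have h0 : ∀ i ∈ Finset.range d, P.coeff i * 0 ^ i = if i = 0 then P.coeff 0 else 0 := by
      intro i _
      rcases eq_or_ne i 0 with rfl | hi <;> simp [*]
    rw [Finset.sum_congr rfl h0]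
    simp [show 0 < d by omega]
  · intro j hj hj0
    rw [← Finset.mul_sum]
    have hj' : ζ ^ j ≠ 1 := hζ.pow_ne_one_of_pos_of_lt hj0 (Finset.mem_range.1 hj)
    have : ∑ k : Fin d, (ζ ^ (k : ℕ)) ^ j = 0 := by
      rw [Fin.sum_univ_eq_sum_range (fun k => (ζ ^ k) ^ j) d]
      simp_rw [← pow_mul, mul_comm _ j, pow_mul]
      have := mul_geom_sum (ζ ^ j) d
      rw [← pow_mul, mul_comm j d, pow_mul, hζ.pow_eq_one, one_pow, sub_self] at this
      exact (mul_eq_zero.1 this).resolve_left (sub_ne_zero.2 hj')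
    rw [this, mul_zero]
  · intro h
    exact absurd (Finset.mem_range.2 (by omega)) h

/-- The functional which takes a form `p` of degree `d` to the coefficient of `t ^ a` in
`p (v + t • w)` is a combination of `d` evaluations if `a < d`. In terms of the forms dual to
these functionals: `ℓ ^ (d - a) * m ^ a` has Waring rank at most `d` for `a < d`. -/
lemma exists_coefficient_functional {d a : ℕ} (had : a < d) (v w : V) :
    ∃ E : (V → ℂ) →ₗ[ℂ] ℂ, IsEvalCombination (linearForms V ^ d) d E ∧
      ∀ α ∈ linearFormsAt v ^ a, ∀ g ∈ linearForms V ^ (d - a), E (α * g) = α w * g v := by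
  rcases Nat.eq_zero_or_pos a with rfl | ha
  · refine ⟨LinearMap.proj v, ?_, ?_⟩
    · have h1 : IsEvalCombination (linearForms V ^ d) 1 (LinearMap.proj v) :=
        ⟨fun _ => 1, fun _ => v, by simp⟩
      exact h1.mono (by omega)
    · intro α hα g hg
      rw [pow_zero, Submodule.mem_one] at hα
      obtain ⟨c, rfl⟩ := hα
      simp [Pi.algebraMap_apply]
  · have hd : (d : ℂ) ≠ 0 := by
      exact_mod_cast (show d ≠ 0 by omega)
    have hζ := Complex.isPrimitiveRoot_exp d (by omega)
    set ζ := Complex.exp (2 * Real.pi * Complex.I / d)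
    have hζ0 : ζ ≠ 0 := Complex.exp_ne_zero _
    refine ⟨∑ k : Fin d, ((d : ℂ)⁻¹ * ((ζ ^ (k : ℕ)) ^ a)⁻¹) •
      (LinearMap.proj (v + ζ ^ (k : ℕ) • w) : (V → ℂ) →ₗ[ℂ] ℂ), ?_, ?_⟩
    · exact ⟨fun k => (d : ℂ)⁻¹ * ((ζ ^ (k : ℕ)) ^ a)⁻¹, fun k => v + ζ ^ (k : ℕ) • w,
        fun p _ => by simp [LinearMap.sum_apply]⟩
    · intro α hα g hg
      obtain ⟨P, hP, hPe⟩ := exists_polynomial_of_mem_pow hg v w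
      have h0 : g v = P.eval 0 := by simpa using hPe 0
      have hterm : ∀ k : Fin d, ((d : ℂ)⁻¹ * ((ζ ^ (k : ℕ)) ^ a)⁻¹) *
          ((α * g) (v + ζ ^ (k : ℕ) • w)) = ((d : ℂ)⁻¹ * α w) * P.eval (ζ ^ (k : ℕ)) := by
        intro k
        have : (ζ ^ (k : ℕ)) ^ a ≠ 0 := pow_ne_zero _ (pow_ne_zero _ hζ0)
        rw [Pi.mul_apply, apply_add_smul_of_mem_pow hα, hPe]
        field_simp
      simp only [LinearMap.sum_apply, LinearMap.smul_apply, LinearMap.proj_apply, smul_eq_mul]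
      rw [Finset.sum_congr rfl fun k _ => hterm k, ← Finset.mul_sum,
        sum_eval_pow_primitiveRoot hζ (by omega), h0]
      field_simp

end

lemma Nat.multichoose_mono_left (k : ℕ) : Monotone fun n => Nat.multichoose n k := by
  refine monotone_nat_of_le_succ fun n => ?_
  cases k with
  | zero => simp
  | succ k => rw [Nat.multichoose_succ_succ]; exact Nat.le_add_right _ _

/-! ### Functionals killed by a product of ideals of points -/

section

variable {V : Type*} [AddCommGroup V] [Module ℂ V]

/-- The forms of least degree in the product of the ideals of the points in `s`. -/
def pointProduct (s : Multiset V) : Submodule ℂ (V → ℂ) := (s.map linearFormsAt).prod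

lemma pointProduct_zero : pointProduct (0 : Multiset V) = 1 := by simp [pointProduct]

lemma pointProduct_cons (v : V) (s : Multiset V) :
    pointProduct (v ::ₘ s) = linearFormsAt v * pointProduct s := by simp [pointProduct]

lemma pointProduct_le (s : Multiset V) : pointProduct s ≤ linearForms V ^ s.card := by
  induction s using Multiset.induction_on with
  | empty => simp [pointProduct_zero]
  | cons v s ih =>
    rw [pointProduct_cons, Multiset.card_cons, pow_succ']
    exact mul_le_mul' (linearFormsAt_le v) ih

/-- Modulo the ideal of `v`, a form `g` is a multiple of a power of a linear form `y` that is `1`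
at `v`. -/
lemma sub_smul_pow_mem {v : V} {y : V → ℂ} (hy : y ∈ linearForms V) (hy1 : y v = 1) {t : ℕ}
    {g : V → ℂ} (hg : g ∈ linearForms V ^ (t + 1)) :
    g - g v • y ^ (t + 1) ∈ linearFormsAt v * linearForms V ^ t := by
  induction t generalizing g with
  | zero =>
    rw [zero_add, pow_one] at hg
    simpa using sub_mem_linearFormsAt hy hy1 hg
  | succ t ih =>
    rw [pow_succ] at hg
    induction hg using Submodule.mul_induction_on' with
    | mem_mul_mem m hm n hn =>
      have h1 : (m - m v • y ^ (t + 1)) * n ∈ linearFormsAt v * linearForms V ^ (t + 1) := by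
        rw [pow_succ, ← mul_assoc]
        exact Submodule.mul_mem_mul (ih hm) hn
      have h2 : m v • ((n - n v • y) * y ^ (t + 1)) ∈
          linearFormsAt v * linearForms V ^ (t + 1) :=
        Submodule.smul_mem _ _ (Submodule.mul_mem_mul (sub_mem_linearFormsAt hy hy1 hn)
          (Submodule.pow_mem_pow _ hy _))
      convert add_mem h1 h2 using 1
      ext x
      simp
      ring
    | add x _ z _ hx hz =>
      convert add_mem hx hz using 1
      ext u
      simp
      ring

/-- If no point of `s` is proportional to `v`, then the forms of least degree in the product of the
ideals of the points of `s` contain some `N` that is `1` at `v`, and, after multiplication by `y`,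
each of them is a multiple of `y * N` modulo the product with the ideal of `v`.
The linear factors are exchanged one by one: a factor `D` vanishing at both `w` and `v` may be used
for the ideal of `v`, as `y` is the sum of a linear form vanishing at `w` and one vanishing at
`v`. -/
lemma exists_mem_pointProduct_eq_one {v : V} {y : V → ℂ} (hy : y ∈ linearForms V) (hy1 : y v = 1)
    (s : Multiset V) (hs : ∀ w ∈ s, v ∉ Submodule.span ℂ {w}) :
    ∃ N ∈ pointProduct s, N v = 1 ∧ ∀ κ ∈ pointProduct s,
      y * κ - κ v • (y * N) ∈ linearFormsAt v * pointProduct s := by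
  induction s using Multiset.induction_on with
  | empty =>
    refine ⟨1, by rw [pointProduct_zero]; exact Submodule.one_le.1 le_rfl, rfl, fun κ hκ => ?_⟩
    rw [pointProduct_zero, Submodule.mem_one] at hκ
    obtain ⟨c, rfl⟩ := hκ
    convert Submodule.zero_mem _ using 1
    ext x
    simp [Pi.algebraMap_apply, mul_comm]
  | cons w s ih =>
    obtain ⟨N, hN, hN1, hNκ⟩ := ih fun u hu => hs u (Multiset.mem_cons_of_mem hu)
    obtain ⟨M, hM, hM1⟩ := exists_mem_linearFormsAt_eq_one (hs w (Multiset.mem_cons_self w s))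
    rw [pointProduct_cons]
    refine ⟨M * N, Submodule.mul_mem_mul hM hN, by simp [hM1, hN1], fun κ hκ => ?_⟩
    induction hκ using Submodule.mul_induction_on' with
    | mem_mul_mem m hm k hk =>
      have hm' := (mem_linearFormsAt.1 hm).1
      have hM' := (mem_linearFormsAt.1 hM).1
      have hDv : m - m v • M ∈ linearFormsAt v := sub_mem_linearFormsAt hM' hM1 hm'
      have hDw : m - m v • M ∈ linearFormsAt w := sub_mem hm (Submodule.smul_mem _ _ hM)
      have hyM : y - M ∈ linearFormsAt v := by
        simpa [hy1] using sub_mem_linearFormsAt hM' hM1 hy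
      have h1 := Submodule.mul_mem_mul hDv (Submodule.mul_mem_mul hM hk)
      have h2 := Submodule.mul_mem_mul hyM (Submodule.mul_mem_mul hDw hk)
      have h3 : m v • (M * (y * k - k v • (y * N))) ∈
          linearFormsAt v * (linearFormsAt w * pointProduct s) := by
        rw [mul_left_comm]
        exact Submodule.smul_mem _ _ (Submodule.mul_mem_mul hM (hNκ k hk))
      convert add_mem (add_mem h1 h2) h3 using 1
      ext x
      simp
      ring
    | add x _ z _ hx hz =>
      convert add_mem hx hz using 1
      ext u
      simp
      ring

/-- One point can be removed from the product of ideals: if `φ` kills the degree `d` part of the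
product of the ideals of the points in `v ::ₘ s`, then it differs from a functional killing the
degree `d` part for `s` by a combination of few evaluations. The latter has the form
`∑ i, c i • E i`, where `E i p` is the coefficient of `t ^ a` in `p (v + t • w i)`
and `a` is the multiplicity of `v` in `s` (up to proportionality). -/
lemma exists_sub_le_ker [FiniteDimensional ℂ V] {v : V} (hv : v ≠ 0) (s : Multiset V) (t : ℕ)
    (φ : (V → ℂ) →ₗ[ℂ] ℂ) (hφ : pointProduct (v ::ₘ s) * linearForms V ^ t ≤ LinearMap.ker φ) :
    ∃ a ≤ s.card, ∃ u : (V → ℂ) →ₗ[ℂ] ℂ,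
      IsEvalCombination (linearForms V ^ (s.card + 1 + t))
        ((Module.finrank ℂ V - 1).multichoose a * (s.card + 1 + t)) u ∧
      pointProduct s * linearForms V ^ (t + 1) ≤ LinearMap.ker (φ - u) := by
  classical
  obtain ⟨y, hy, hy1⟩ := exists_mem_linearForms_eq_one hv
  set s₁ := s.filter fun w => v ∈ Submodule.span ℂ {w}
  set s₂ := s.filter fun w => ¬ v ∈ Submodule.span ℂ {w}
  have hss : s₁ + s₂ = s := Multiset.filter_add_not _ s
  set a := s₁.card
  set d := s.card + 1 + t
  have hcard : a + s₂.card = s.card := by rw [← Multiset.card_add, hss]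
  have hprod : pointProduct s = linearFormsAt v ^ a * pointProduct s₂ := by
    rw [← hss, pointProduct, Multiset.map_add, Multiset.prod_add]
    congr 1
    rw [Multiset.map_congr rfl fun w hw =>
      linearFormsAt_eq_of_mem_span hv (Multiset.mem_filter.1 hw).2]
    rw [Multiset.map_const', Multiset.prod_replicate]
  obtain ⟨N, hN, hN1, hNκ⟩ := exists_mem_pointProduct_eq_one hy hy1 s₂
    fun w hw => (Multiset.mem_filter.1 hw).2
  rw [pointProduct_cons, hprod] at hφ
  -- Modulo the kernel of `φ`, a product is determined by its factor vanishing to order `a` at `v`.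
  have key : ∀ α ∈ linearFormsAt v ^ a, ∀ κ ∈ pointProduct s₂, ∀ g ∈ linearForms V ^ (t + 1),
      φ (α * κ * g) = g v * κ v * φ (α * (y ^ (t + 1) * N)) := by
    intro α hα κ hκ g hg
    have h1 : α * κ * (g - g v • y ^ (t + 1)) ∈ LinearMap.ker φ := by
      refine hφ ?_
      have := Submodule.mul_mem_mul (Submodule.mul_mem_mul hα hκ) (sub_smul_pow_mem hy hy1 hg)
      rwa [← mul_assoc, mul_comm _ (linearFormsAt v)] at this
    have h2 : α * (y * κ - κ v • (y * N)) * y ^ t ∈ LinearMap.ker φ := by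
      refine hφ ?_
      have := Submodule.mul_mem_mul (Submodule.mul_mem_mul hα (hNκ κ hκ))
        (Submodule.pow_mem_pow _ hy t)
      rwa [mul_left_comm] at this
    have h3 : α * κ * g = α * κ * (g - g v • y ^ (t + 1)) +
        g v • (α * (y * κ - κ v • (y * N)) * y ^ t) +
        (g v * κ v) • (α * (y ^ (t + 1) * N)) := by
      ext x
      simp
      ring
    rw [h3, map_add, map_add, map_smul, map_smul, LinearMap.mem_ker.1 h1, LinearMap.mem_ker.1 h2]
    simp
  obtain ⟨hfin, hrank⟩ := (linearFormsAt v).finrank_pow_le a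
  obtain ⟨c, w, hcw⟩ := IsEvalCombination.of_finrank (A := linearFormsAt v ^ a)
    (φ ∘ₗ LinearMap.mulRight ℂ (y ^ (t + 1) * N))
  choose E hE hEval using fun j => exists_coefficient_functional (d := d) (a := a) (by omega) v (w j)
  refine ⟨a, by omega, ∑ j, c j • E j, ?_, ?_⟩
  · refine (IsEvalCombination.sum_smul c E hE).mono (Nat.mul_le_mul_right _ (hrank.trans ?_))
    exact Nat.multichoose_mono_left _ (Nat.le_sub_one_of_lt (finrank_linearFormsAt_lt hv))
  · rw [hprod]
    refine Submodule.mul_le.2 fun x hx g hg => ?_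
    induction hx using Submodule.mul_induction_on' with
    | mem_mul_mem α hα κ hκ =>
      have hκg : κ * g ∈ linearForms V ^ (d - a) := by
        rw [show d - a = s₂.card + (t + 1) by omega, pow_add]
        exact Submodule.mul_mem_mul (pointProduct_le s₂ hκ) hg
      have h4 := hcw α hα
      simp only [LinearMap.comp_apply, LinearMap.mulRight_apply] at h4
      rw [LinearMap.mem_ker, LinearMap.sub_apply, key α hα κ hκ g hg, h4, mul_assoc α,
        LinearMap.sum_apply, sub_eq_zero, Finset.mul_sum]
      refine Finset.sum_congr rfl fun j _ => ?_
      rw [LinearMap.smul_apply, hEval j α hα _ hκg]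
      simp
      ring
    | add x _ z _ hx hz => rw [add_mul]; exact add_mem hx hz

/-- A functional on the forms of degree `d ≥ r` which kills the product of the ideals of `r` points
is a combination of few evaluations. -/
lemma isEvalCombination_of_pointProduct_le_ker [FiniteDimensional ℂ V] (B : ℕ → ℕ)
    (hB : Monotone B) (hVB : ∀ a, (Module.finrank ℂ V - 1).multichoose a ≤ B a)
    (s : Multiset V) (hs : ∀ v ∈ s, v ≠ 0) (t : ℕ) (φ : (V → ℂ) →ₗ[ℂ] ℂ)
    (hφ : pointProduct s * linearForms V ^ t ≤ LinearMap.ker φ) :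
    IsEvalCombination (linearForms V ^ (s.card + t))
      ((∑ j ∈ Finset.range s.card, B j) * (s.card + t)) φ := by
  induction s using Multiset.induction_on generalizing t φ with
  | empty =>
    rw [pointProduct_zero, one_mul] at hφ
    simpa using IsEvalCombination.zero_of_le_ker hφ
  | cons v s ih =>
    obtain ⟨a, ha, u, hu, hker⟩ := exists_sub_le_ker (hs v (Multiset.mem_cons_self v s)) s t φ hφ
    have h := ih (fun w hw => hs w (Multiset.mem_cons_of_mem hw)) (t + 1) _ hker
    rw [Multiset.card_cons, Finset.sum_range_succ]
    rw [show s.card + (t + 1) = s.card + 1 + t by ring] at h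
    have := h.add hu
    rw [sub_add_cancel] at this
    refine this.mono ?_
    rw [add_mul]
    exact Nat.add_le_add_left (Nat.mul_le_mul_right _ ((hVB a).trans (hB ha))) _

end

/-! ### Limits of sums of evaluations -/

lemma apply_smul_of_mem_pow {V : Type*} [AddCommGroup V] [Module ℂ V] {d : ℕ} {p : V → ℂ}
    (hp : p ∈ linearForms V ^ d) (t : ℂ) (w : V) :
    p (t • w) = t ^ d * p w := by
  have h0 : linearFormsAt (0 : V) = linearForms V :=
    le_antisymm (linearFormsAt_le _) fun q hq => mem_linearFormsAt.2 ⟨hq, by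
      obtain ⟨l, rfl⟩ := mem_linearForms.1 hq
      simp⟩
  rw [← h0] at hp
  simpa using apply_add_smul_of_mem_pow hp t w

section

variable {V : Type*} [NormedAddCommGroup V] [NormedSpace ℂ V] [FiniteDimensional ℂ V]

lemma continuous_of_mem_linearForms {p : V → ℂ} (hp : p ∈ linearForms V) : Continuous p := by
  obtain ⟨l, rfl⟩ := mem_linearForms.1 hp
  exact l.continuous_of_finiteDimensional

open scoped Pointwise in
/-- If the points of sums of `r` evaluations converge to nonzero points, then a limit of these sums
kills the product of the ideals of the limit points. Indeed a product of linear forms vanishing at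
the limit points is the limit of products of linear forms vanishing at the points of the
sequence. -/
lemma pointProduct_le_ker_of_tendsto {r t : ℕ} (c : ℕ → Fin r → ℂ) (v : ℕ → Fin r → V)
    (v₀ : Fin r → V) (hv₀ : ∀ k, v₀ k ≠ 0)
    (hv : ∀ k, Tendsto (fun i => v i k) atTop (𝓝 (v₀ k))) (φ : (V → ℂ) →ₗ[ℂ] ℂ)
    (hφ : ∀ p ∈ linearForms V ^ (r + t),
      Tendsto (fun i => ∑ k, c i k * p (v i k)) atTop (𝓝 (φ p))) :
    pointProduct (Finset.univ.val.map v₀) * linearForms V ^ t ≤ LinearMap.ker φ := by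
  classical
  have hprod : pointProduct (Finset.univ.val.map v₀) = ∏ k, linearFormsAt (v₀ k) := by
    rw [pointProduct, Multiset.map_map]
    rfl
  rw [hprod]
  refine Submodule.mul_le.2 fun x hx h hh => ?_
  have hspan : ∏ k, linearFormsAt (v₀ k) =
      Submodule.span ℂ (∏ k, (linearFormsAt (v₀ k) : Set (V → ℂ))) := by
    rw [← Submodule.prod_span]
    simp
  rw [hspan] at hx
  induction hx using Submodule.span_induction with
  | zero => simp
  | add x y _ _ hx hy => rw [add_mul]; exact add_mem hx hy
  | smul a x _ hx => rw [smul_mul_assoc]; exact Submodule.smul_mem _ _ hx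
  | mem x hx =>
  obtain ⟨f, hf, rfl⟩ := (Set.mem_fintype_prod _ _).1 hx
  choose M hM hM1 using fun k => exists_mem_linearForms_eq_one (hv₀ k)
  have hfL : ∀ k, f k ∈ linearForms V := fun k => (mem_linearFormsAt.1 (hf k)).1
  let ε : ℕ → Fin r → ℂ := fun i k => -(f k (v i k) / M k (v i k))
  have hMt : ∀ k, Tendsto (fun i => M k (v i k)) atTop (𝓝 1) := fun k => by
    rw [← hM1 k]
    exact ((continuous_of_mem_linearForms (hM k)).tendsto _).comp (hv k)
  have hft : ∀ k, Tendsto (fun i => f k (v i k)) atTop (𝓝 0) := fun k => by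
    rw [← (mem_linearFormsAt.1 (hf k)).2]
    exact ((continuous_of_mem_linearForms (hfL k)).tendsto _).comp (hv k)
  have hε : ∀ k, Tendsto (fun i => ε i k) atTop (𝓝 0) := fun k => by
    simpa using ((hft k).div (hMt k) one_ne_zero).neg
  let Φ : ℕ → (V → ℂ) → ℂ := fun i p => ∑ k, c i k * p (v i k)
  let q : Finset (Fin r) → (V → ℂ) := fun S => (∏ k ∈ S, f k) * (∏ k ∈ Finset.univ \ S, M k) * h
  have hq : ∀ S, q S ∈ linearForms V ^ (r + t) := by
    intro S
    have hmem : ∀ (T : Finset (Fin r)) (g : Fin r → V → ℂ), (∀ k, g k ∈ linearForms V) →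
        ∏ k ∈ T, g k ∈ linearForms V ^ T.card := by
      intro T g hg
      induction T using Finset.induction_on with
      | empty => simp
      | insert k T hk ih =>
        rw [Finset.prod_insert hk, Finset.card_insert_of_notMem hk, pow_succ']
        exact Submodule.mul_mem_mul (hg k) ih
    have hcard : S.card + (Finset.univ \ S).card = r := by
      rw [add_comm, Finset.card_sdiff_add_card_eq_card (Finset.subset_univ S), Finset.card_fin]
    rw [← hcard, pow_add, pow_add]
    exact Submodule.mul_mem_mul (Submodule.mul_mem_mul (hmem S f hfL) (hmem _ M hM)) hh
  have hexp : ∀ i, (∏ k, (f k + ε i k • M k)) * h =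
      ∑ S ∈ Finset.univ.powerset, (∏ k ∈ Finset.univ \ S, ε i k) • q S := by
    intro i
    rw [Finset.prod_add, Finset.sum_mul]
    refine Finset.sum_congr rfl fun S _ => ?_
    rw [Finset.prod_smul]
    ext x
    simp [q]
    ring
  have hlim : Tendsto (fun i => Φ i ((∏ k, (f k + ε i k • M k)) * h)) atTop
      (𝓝 (φ ((∏ k, f k) * h))) := by
    have h1 : ∀ i, Φ i ((∏ k, (f k + ε i k • M k)) * h) =
        ∑ S ∈ Finset.univ.powerset, (∏ k ∈ Finset.univ \ S, ε i k) * Φ i (q S) := by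
      intro i
      rw [hexp i]
      simp only [Φ, Finset.sum_apply, Pi.smul_apply, smul_eq_mul, Finset.mul_sum]
      rw [Finset.sum_comm]
      refine Finset.sum_congr rfl fun S _ => Finset.sum_congr rfl fun k _ => ?_
      ring
    simp_rw [h1]
    have h2 : φ ((∏ k, f k) * h) = ∑ S ∈ (Finset.univ : Finset (Fin r)).powerset,
        (∏ k ∈ Finset.univ \ S, (0 : ℂ)) * φ (q S) := by
      rw [Finset.sum_eq_single Finset.univ]
      · simp [q]
      · intro S _ hS
        rw [Finset.prod_eq_zero_iff.2, zero_mul]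
        obtain ⟨k, hk⟩ : ∃ k, k ∉ S := by
          by_contra! hall
          exact hS (Finset.eq_univ_iff_forall.2 hall)
        exact ⟨k, by simpa using hk, rfl⟩
      · simp
    rw [h2]
    exact tendsto_finsetSum _ fun S _ =>
      (tendsto_finsetProd _ fun k _ => hε k).mul (hφ _ (hq S))
  have hzero : ∀ᶠ i in atTop, Φ i ((∏ k, (f k + ε i k • M k)) * h) = 0 := by
    have hne : ∀ᶠ i in atTop, ∀ k, M k (v i k) ≠ 0 :=
      eventually_all.2 fun k => (hMt k).eventually_ne one_ne_zero
    filter_upwards [hne] with i hi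
    refine Finset.sum_eq_zero fun k _ => ?_
    rw [Pi.mul_apply, Finset.prod_apply, Finset.prod_eq_zero (Finset.mem_univ k), zero_mul,
      mul_zero]
    have := hi k
    simp only [Pi.add_apply, Pi.smul_apply, smul_eq_mul, ε]
    field_simp
    ring
  exact tendsto_nhds_unique hlim (tendsto_const_nhds.congr' (hzero.mono fun i hi => hi.symm))

lemma sum_range_choose_add_eq {r : ℕ} (hr : 1 ≤ r) :
    ∑ j ∈ Finset.range r, (r - 2 + j).choose j = (2 * r - 2).choose (r - 1) := by
  obtain rfl | ⟨k, rfl⟩ : r = 1 ∨ ∃ k, r = k + 2 := by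
    rcases r with _ | _ | k
    · omega
    · exact Or.inl rfl
    · exact Or.inr ⟨k, rfl⟩
  · simp
  · rw [show 2 * (k + 2) - 2 = (k + 1) + (k + 1) by omega, show k + 2 - 1 = k + 1 by omega,
      ← Nat.sum_range_multichoose (k + 1) (k + 1)]
    refine Finset.sum_congr rfl fun j _ => ?_
    rw [Nat.multichoose_eq]
    congr 1
    omega

/-- On a space of dimension at most `r`, a limit of sums of `r` evaluations of forms of degree `d`
is a combination of few evaluations. -/
lemma isEvalCombination_of_tendsto_of_finrank_le {d r : ℕ} (hd : 1 ≤ d)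
    (hV : Module.finrank ℂ V ≤ r) (v : ℕ → Fin r → V) (φ : (V → ℂ) →ₗ[ℂ] ℂ)
    (hφ : ∀ p ∈ linearForms V ^ d,
      Tendsto (fun i => ∑ k, p (v i k)) atTop (𝓝 (φ p))) :
    IsEvalCombination (linearForms V ^ d) ((2 * r - 2).choose (r - 1) * d) φ := by
  obtain ⟨hfin, hrank⟩ := (linearForms V).finrank_pow_le d
  rw [finrank_linearForms] at hrank
  rcases Nat.eq_zero_or_pos (Module.finrank ℂ V) with h0 | hpos
  · refine (IsEvalCombination.of_finrank φ).mono (hrank.trans ?_)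
    obtain ⟨e, rfl⟩ := Nat.exists_eq_add_of_le' hd
    simp [h0]
  rcases lt_or_ge d r with hdr | hdr
  · -- In small degree, the dimension of the space of forms is already a good bound.
    refine (IsEvalCombination.of_finrank φ).mono
      ((hrank.trans (Nat.multichoose_mono_left d hV)).trans ?_)
    refine le_trans ?_ (Nat.le_mul_of_pos_right _ hd)
    simp only [Nat.multichoose_eq]
    rw [Nat.choose_symm_of_eq_add (show r + d - 1 = d + (r - 1) by omega)]
    exact Nat.choose_le_choose _ (by omega)
  · obtain ⟨t, rfl⟩ := Nat.exists_eq_add_of_le hdr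
    have : Nontrivial V := Module.finrank_pos_iff.1 hpos
    -- Rescale the points to the unit sphere, where a subsequence converges.
    have hdec : ∀ x : V, ∃ (a : ℂ) (y : V), ‖y‖ = 1 ∧ x = a • y := by
      have hne : ∀ x : V, x ≠ 0 → ‖((‖x‖ : ℂ)⁻¹ • x)‖ = 1 := fun x hx => by
        rw [norm_smul, norm_inv, Complex.norm_real, norm_norm,
          inv_mul_cancel₀ (norm_ne_zero_iff.2 hx)]
      intro x
      by_cases hx : x = 0
      · obtain ⟨u, hu⟩ := exists_ne (0 : V)
        exact ⟨0, _, hne u hu, by simp [hx]⟩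
      · refine ⟨‖x‖, _, hne x hx, ?_⟩
        rw [smul_inv_smul₀]
        exact_mod_cast norm_ne_zero_iff.2 hx
    choose a y hy hay using hdec
    have : ProperSpace V := FiniteDimensional.proper ℂ V
    have hcomp : IsCompact (Set.univ.pi fun _ : Fin r => Metric.sphere (0 : V) 1) :=
      isCompact_univ_pi fun _ => isCompact_sphere _ _
    obtain ⟨v₀, hv₀, σ, hσ, hlim⟩ := hcomp.tendsto_subseq (x := fun i k => y (v i k))
      fun i k _ => by simp [hy]
    have hker := pointProduct_le_ker_of_tendsto (t := t) (fun i k => a (v (σ i) k) ^ (r + t))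
      (fun i k => y (v (σ i) k)) v₀ (fun k hk => by simpa [hk] using hv₀ k trivial)
      (fun k => (tendsto_pi_nhds.1 hlim) k) φ fun p hp => by
        refine ((hφ p hp).comp hσ.tendsto_atTop).congr fun i => ?_
        refine Finset.sum_congr rfl fun k _ => ?_
        rw [← apply_smul_of_mem_pow hp, ← hay]
    have := isEvalCombination_of_pointProduct_le_ker (fun j => (r - 2 + j).choose j)
      (monotone_nat_of_le_succ fun j => ?_) (fun j => ?_) _ (fun w hw => ?_) t φ hker
    · rwa [Multiset.card_map, Finset.card_val, Finset.card_fin,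
        sum_range_choose_add_eq (by omega)] at this
    · rw [← add_assoc, Nat.choose_succ_succ]
      exact Nat.le_add_right _ _
    · rcases Nat.eq_zero_or_pos j with rfl | hj
      · simp
      · rw [Nat.multichoose_eq]
        exact Nat.choose_le_choose _ (by omega)
    · obtain ⟨k, -, rfl⟩ := Multiset.mem_map.1 hw
      intro hk
      simpa [hk] using hv₀ k trivial

end

/-! ### Reduction to few variables -/

lemma comp_mem_linearForms_pow {V W : Type*} [AddCommGroup V] [Module ℂ V] [AddCommGroup W]
    [Module ℂ W] (g : W →ₗ[ℂ] V) {d : ℕ} {p : V → ℂ} (hp : p ∈ linearForms V ^ d) :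
    p ∘ g ∈ linearForms W ^ d := by
  induction d generalizing p with
  | zero =>
    rw [pow_zero, Submodule.mem_one] at hp
    obtain ⟨c, rfl⟩ := hp
    rw [pow_zero, Submodule.mem_one]
    exact ⟨c, rfl⟩
  | succ d ih =>
    rw [pow_succ] at hp
    induction hp using Submodule.mul_induction_on' with
    | mem_mul_mem m hm n hn =>
      obtain ⟨l, rfl⟩ := mem_linearForms.1 hn
      rw [pow_succ]
      exact Submodule.mul_mem_mul (ih hm) ⟨l ∘ₗ g, rfl⟩
    | add x _ y _ hx hy => exact add_mem hx hy

/-- If a functional kills all multiples of the linear forms `l - l ∘ π`, then it does not distinguish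
a form `p` from `p ∘ π`. For a projection `π`, these linear forms are the ones that vanish on the
range of `π`. -/
lemma apply_comp_eq_of_mul_eq_zero {V : Type*} [AddCommGroup V] [Module ℂ V] (π : V →ₗ[ℂ] V)
    (φ : (V → ℂ) →ₗ[ℂ] ℂ) {d : ℕ}
    (h : ∀ l : V →ₗ[ℂ] ℂ, ∀ q ∈ linearForms V ^ (d - 1), φ ((⇑l - ⇑l ∘ π) * q) = 0)
    {e : ℕ} (hed : e ≤ d) {p q : V → ℂ} (hp : p ∈ linearForms V ^ e)
    (hq : q ∈ linearForms V ^ (d - e)) : φ (p * q) = φ ((p ∘ π) * q) := by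
  induction e generalizing p q with
  | zero =>
    rw [pow_zero, Submodule.mem_one] at hp
    obtain ⟨c, rfl⟩ := hp
    rfl
  | succ e ih =>
    rw [pow_succ] at hp
    induction hp using Submodule.mul_induction_on' with
    | mem_mul_mem m hm n hn =>
      obtain ⟨l, rfl⟩ := mem_linearForms.1 hn
      have h1 : ⇑l * q ∈ linearForms V ^ (d - e) := by
        rw [show d - e = (d - (e + 1)) + 1 by omega, pow_succ']
        exact Submodule.mul_mem_mul hn hq
      have h2 : (m ∘ π) * q ∈ linearForms V ^ (d - 1) := by
        rw [show d - 1 = e + (d - (e + 1)) by omega, pow_add]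
        exact Submodule.mul_mem_mul (comp_mem_linearForms_pow π hm) hq
      have h3 := h l _ h2
      have h4 : (⇑l - ⇑l ∘ π) * ((m ∘ π) * q) =
          (m ∘ π) * (⇑l * q) - ((m * ⇑l) ∘ π) * q := by
        ext x
        simp
        ring
      rw [h4, map_sub, sub_eq_zero] at h3
      rw [mul_assoc, ih (by omega) hm h1, h3]
    | add x _ y _ hx hy =>
      rw [add_mul, map_add, hx, hy, ← map_add, ← add_mul]
      rfl

section

variable {V : Type*} [NormedAddCommGroup V] [NormedSpace ℂ V] [FiniteDimensional ℂ V]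

/-- A linear map which is a pointwise limit of linear maps with values in spans of `r` vectors has
rank at most `r`, since linear independence is an open condition. -/
lemma finrank_range_le_of_tendsto {D E : Type*} [AddCommGroup D] [Module ℂ D]
    [NormedAddCommGroup E] [NormedSpace ℂ E] {r : ℕ} (T : D →ₗ[ℂ] E)
    (S : ℕ → D → E) (x : ℕ → Fin r → E)
    (hS : ∀ i l, S i l ∈ Submodule.span ℂ (Set.range (x i)))
    (hT : ∀ l, Tendsto (fun i => S i l) atTop (𝓝 (T l))) :
    Module.finrank ℂ (LinearMap.range T) ≤ r := by
  by_contra! hlt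
  obtain ⟨f, hf⟩ := exists_linearIndependent_of_le_finrank (Nat.succ_le_of_lt hlt)
  choose l hl using fun j => (f j).2
  have hli : LinearIndependent ℂ fun j => T (l j) := by
    have : (fun j => T (l j)) = (LinearMap.range T).subtype ∘ f := funext fun j => hl j
    rw [this]
    exact hf.map' _ (Submodule.ker_subtype _)
  have hev := (tendsto_pi_nhds.2 fun j => hT (l j)).eventually hli.eventually
  obtain ⟨i, hi⟩ := hev.exists
  have h1 := finrank_span_eq_card hi
  have h2 : Submodule.span ℂ (Set.range fun j => S i (l j)) ≤
      Submodule.span ℂ (Set.range (x i)) :=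
    Submodule.span_le.2 (by rintro _ ⟨j, rfl⟩; exact hS i (l j))
  have := FiniteDimensional.span_of_finite ℂ (Set.finite_range (x i))
  have h3 := Submodule.finrank_mono h2
  have h4 : Module.finrank ℂ (Submodule.span ℂ (Set.range (x i))) ≤ _ :=
    finrank_range_le_card (R := ℂ) (x i)
  rw [Fintype.card_fin] at h1 h4
  omega

/-- A limit of sums of `r` evaluations of forms of degree `d` only depends on the restrictions of the
forms to a subspace of dimension at most `r`, and thus is a combination of few evaluations. -/
lemma isEvalCombination_of_tendsto {d r : ℕ} (hd : 1 ≤ d) (v : ℕ → Fin r → V)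
    (φ : (V → ℂ) →ₗ[ℂ] ℂ)
    (hφ : ∀ p ∈ linearForms V ^ d,
      Tendsto (fun i => ∑ k, p (v i k)) atTop (𝓝 (φ p))) :
    IsEvalCombination (linearForms V ^ d) ((2 * r - 2).choose (r - 1) * d) φ := by
  obtain ⟨hfin, -⟩ := (linearForms V).finrank_pow_le (d - 1)
  let b := Module.finBasis ℂ ↥(linearForms V ^ (d - 1))
  have hmul : ∀ (l : V →ₗ[ℂ] ℂ), ∀ q ∈ linearForms V ^ (d - 1), ⇑l * q ∈ linearForms V ^ d := by
    intro l q hq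
    obtain ⟨e, rfl⟩ := Nat.exists_eq_add_of_le' hd
    rw [pow_succ']
    exact Submodule.mul_mem_mul ⟨l, rfl⟩ hq
  -- The catalecticant of `φ`, pairing linear forms with forms of degree `d - 1`.
  let T : (V →ₗ[ℂ] ℂ) →ₗ[ℂ] (Fin (Module.finrank ℂ ↥(linearForms V ^ (d - 1))) → ℂ) :=
    LinearMap.pi fun j => φ ∘ₗ LinearMap.mulRight ℂ (b j : V → ℂ) ∘ₗ LinearMap.ltoFun ℂ V ℂ ℂ
  have hTapp : ∀ l j, T l j = φ (⇑l * (b j : V → ℂ)) := fun l j => rfl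
  have hrank : Module.finrank ℂ (LinearMap.range T) ≤ r := by
    refine finrank_range_le_of_tendsto T
      (fun i l => ∑ k, l (v i k) • fun j => (b j : V → ℂ) (v i k))
      (fun i k j => (b j : V → ℂ) (v i k)) (fun i l => ?_) fun l => ?_
    · exact Submodule.sum_mem _ fun k _ =>
        Submodule.smul_mem _ _ (Submodule.subset_span ⟨k, rfl⟩)
    · rw [tendsto_pi_nhds]
      intro j
      rw [hTapp]
      refine (hφ _ (hmul l _ (b j).2)).congr fun i => ?_
      simp [Finset.sum_apply]
  have hkerT : ∀ l ∈ LinearMap.ker T, ∀ q ∈ linearForms V ^ (d - 1), φ (⇑l * q) = 0 := by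
    intro l hl q hq
    have hcomp : (φ ∘ₗ LinearMap.mulLeft ℂ (⇑l : V → ℂ) ∘ₗ
        (linearForms V ^ (d - 1)).subtype) = 0 :=
      b.ext fun j => by simpa [hTapp] using congrFun (LinearMap.mem_ker.1 hl) j
    exact LinearMap.congr_fun hcomp ⟨q, hq⟩
  let W : Submodule ℂ V := (LinearMap.ker T).dualCoannihilator
  have hW : Module.finrank ℂ W ≤ r := by
    have h1 := Subspace.finrank_add_finrank_dualCoannihilator_eq (LinearMap.ker T)
    have h2 := LinearMap.finrank_range_add_finrank_ker T
    have h3 : Module.finrank ℂ (V →ₗ[ℂ] ℂ) = Module.finrank ℂ V := Subspace.dual_finrank_eq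
    change Module.finrank ℂ (LinearMap.ker T) + Module.finrank ℂ W = _ at h1
    omega
  obtain ⟨P, hP⟩ := W.subtype.exists_leftInverse_of_injective W.ker_subtype
  have hproj : ∀ p ∈ linearForms V ^ d, φ p = φ (p ∘ (W.subtype ∘ₗ P)) := by
    intro p hp
    have := apply_comp_eq_of_mul_eq_zero (W.subtype ∘ₗ P) φ (d := d) (q := 1) (fun l q hq => ?_)
      le_rfl hp (by simp)
    · simpa using this
    · refine hkerT (l - l ∘ₗ (W.subtype ∘ₗ P)) ?_ q hq
      rw [← Subspace.dualCoannihilator_dualAnnihilator_eq (W := LinearMap.ker T),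
        Submodule.mem_dualAnnihilator]
      intro w hw
      have : P w = ⟨w, hw⟩ := LinearMap.congr_fun hP ⟨w, hw⟩
      simp [this]
  obtain ⟨c, w, hcw⟩ := isEvalCombination_of_tendsto_of_finrank_le hd hW (fun i k => P (v i k))
    (φ ∘ₗ LinearMap.funLeft ℂ ℂ P) fun p hp => hφ _ (comp_mem_linearForms_pow P hp)
  refine ⟨c, fun j => w j, fun p hp => ?_⟩
  rw [hproj p hp]
  exact hcw _ (comp_mem_linearForms_pow W.subtype hp)

end

/-! ### Waring decompositions as combinations of evaluations -/

/-- A polynomial as a function on affine space. -/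
noncomputable def evalFunction (n : ℕ) : MvPolynomial (Fin n) ℂ →ₐ[ℂ] ((Fin n → ℂ) → ℂ) :=
  aeval fun i x => x i

lemma evalFunction_apply {n : ℕ} (p : MvPolynomial (Fin n) ℂ) (x : Fin n → ℂ) :
    evalFunction n p x = eval x p := by
  induction p using MvPolynomial.induction_on with
  | C a => simp [evalFunction, Pi.algebraMap_apply]
  | add p q hp hq => simp [hp, hq]
  | mul_X p i hp => rw [map_mul, Pi.mul_apply, hp, map_mul]; simp [evalFunction]

lemma linearForms_pow_eq_map (n d : ℕ) :
    linearForms (Fin n → ℂ) ^ d =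
      (homogeneousSubmodule (Fin n) ℂ d).map (evalFunction n).toLinearMap := by
  rw [← homogeneousSubmodule_one_pow, Submodule.map_pow]
  congr 1
  rw [homogeneousSubmodule_one_eq_span_X, Submodule.map_span, ← Set.range_comp]
  apply le_antisymm
  · rintro p hp
    obtain ⟨l, rfl⟩ := mem_linearForms.1 hp
    have : (⇑l : (Fin n → ℂ) → ℂ) =
        ∑ i, l (Pi.single i 1) • (((evalFunction n).toLinearMap ∘ X) i) := by
      ext x
      conv_lhs => rw [← LinearMap.sum_single_apply (fun _ => ℂ) x]
      rw [map_sum, Finset.sum_apply]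
      refine Finset.sum_congr rfl fun i _ => ?_
      have : Pi.single i (x i) = x i • (Pi.single i 1 : Fin n → ℂ) := by
        rw [← Pi.single_smul]; simp
      simp [this, evalFunction, mul_comm]
    rw [this]
    exact Submodule.sum_mem _ fun i _ => Submodule.smul_mem _ _ (Submodule.subset_span ⟨i, rfl⟩)
  · rw [Submodule.span_le]
    rintro _ ⟨i, rfl⟩
    exact ⟨LinearMap.proj i, by ext x; simp [evalFunction]⟩

/-- The linear form whose coefficient vector is `a`. -/
noncomputable def linearFormOf {n : ℕ} (a : Fin n → ℂ) : MvPolynomial (Fin n) ℂ := ∑ i, a i • X i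

lemma isHomogeneous_linearFormOf {n : ℕ} (a : Fin n → ℂ) : (linearFormOf a).IsHomogeneous 1 :=
  (homogeneousSubmodule (Fin n) ℂ 1).sum_mem fun i _ =>
    Submodule.smul_mem _ _ (isHomogeneous_X ℂ i)

lemma exists_eq_linearFormOf {n : ℕ} {p : MvPolynomial (Fin n) ℂ} (hp : p.IsHomogeneous 1) :
    ∃ a, p = linearFormOf a := by
  have : p ∈ homogeneousSubmodule (Fin n) ℂ 1 := hp
  rw [homogeneousSubmodule_one_eq_span_X] at this
  obtain ⟨a, ha⟩ := (Submodule.mem_span_range_iff_exists_fun ℂ).1 this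
  exact ⟨a, ha.symm⟩

/-- The value of a monomial at `a` is the coefficient of that monomial in the power of the linear
form with coefficients `a`, divided by the multinomial coefficient. -/
lemma coeff_linearFormOf_pow {n d : ℕ} (a : Fin n → ℂ) (m : Fin n →₀ ℕ) :
    coeff m (linearFormOf a ^ d) =
      if m.degree = d then m.multinomial * eval a (monomial m 1) else 0 := by
  rw [linearFormOf, coeff_linearCombination_X_pow_of_fintype, eval_monomial, one_mul]
  rfl

lemma Finsupp.multinomial_cast_ne_zero {σ : Type*} (m : σ →₀ ℕ) : (m.multinomial : ℂ) ≠ 0 := by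
  exact_mod_cast (Nat.multinomial_pos m.support m).ne'

/-- A functional on functions that represents `f` through the apolarity pairing, which takes the
power of a linear form to the evaluation at its coefficient vector. It is prescribed on polynomial
functions only. -/
lemma exists_apolar_functional {n : ℕ} (f : MvPolynomial (Fin n) ℂ) :
    ∃ φ : ((Fin n → ℂ) → ℂ) →ₗ[ℂ] ℂ, ∀ m,
      φ (evalFunction n (monomial m 1)) = coeff m f / m.multinomial := by
  obtain ⟨g, hg⟩ := (evalFunction n).toLinearMap.exists_leftInverse_of_injective
    (LinearMap.ker_eq_bot.2 fun p q hpq => MvPolynomial.funext fun x => by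
      rw [← evalFunction_apply, ← evalFunction_apply]
      exact congrFun hpq x)
  refine ⟨(basisMonomials (Fin n) ℂ).constr ℂ (fun m => coeff m f / m.multinomial) ∘ₗ g,
    fun m => ?_⟩
  have h1 : g (evalFunction n (monomial m 1)) = monomial m 1 := LinearMap.congr_fun hg _
  rw [LinearMap.comp_apply, h1]
  have := (basisMonomials (Fin n) ℂ).constr_basis ℂ
    (fun m => coeff m f / (m.multinomial : ℂ)) m
  rwa [coe_basisMonomials] at this

namespace HasWaringDecomposition

variable {n d : ℕ} {f : MvPolynomial (Fin n) ℂ}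

lemma mono {r s : ℕ} (hd : 1 ≤ d) (hrs : r ≤ s) (h : HasWaringDecomposition d r f) :
    HasWaringDecomposition d s f := by
  obtain ⟨l, hl, rfl⟩ := h
  obtain ⟨k, rfl⟩ := Nat.exists_eq_add_of_le hrs
  refine ⟨Fin.append l fun _ => 0, fun j => ?_, ?_⟩
  · induction j using Fin.addCases with
    | left i => simpa using hl i
    | right i => simpa using isHomogeneous_zero _ _ _
  · rw [Fin.sum_univ_add]
    simp [show d ≠ 0 by omega]

lemma of_waringRank_le {r : ℕ} (hd : 1 ≤ d) (h : waringRank d f ≤ (r : ℕ∞)) :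
    HasWaringDecomposition d r f := by
  by_contra hr
  have h1 : ((r + 1 : ℕ) : ℕ∞) ≤ waringRank d f := by
    refine le_iInf₂ fun s hs => ?_
    by_contra! hlt
    exact hr (hs.mono hd (by have := ENat.natCast_lt_natCast.1 hlt; omega))
  have := ENat.natCast_le_natCast.1 (h1.trans h)
  omega

/-- A form is a sum of `B` powers if its apolar functional is a combination of `B` evaluations; the
coefficients are absorbed by taking `d`-th roots. -/
lemma of_isEvalCombination {B : ℕ} (hd : 1 ≤ d) (hf : f.IsHomogeneous d)
    (φ : ((Fin n → ℂ) → ℂ) →ₗ[ℂ] ℂ)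
    (hφ : ∀ m, φ (evalFunction n (monomial m 1)) = coeff m f / m.multinomial)
    (h : IsEvalCombination (linearForms (Fin n → ℂ) ^ d) B φ) : HasWaringDecomposition d B f := by
  obtain ⟨c, w, hcw⟩ := h
  choose z hz using fun j => IsAlgClosed.exists_pow_nat_eq (c j) (show 0 < d by omega)
  refine ⟨fun j => z j • linearFormOf (w j), fun j =>
    (homogeneousSubmodule (Fin n) ℂ 1).smul_mem _ (isHomogeneous_linearFormOf _), ?_⟩
  ext m
  simp only [smul_pow, hz, coeff_sum, coeff_smul, coeff_linearFormOf_pow, smul_eq_mul]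
  by_cases hm : m.degree = d
  · have hmem : evalFunction n (monomial m 1) ∈ linearForms (Fin n → ℂ) ^ d := by
      rw [linearForms_pow_eq_map]
      exact ⟨_, isHomogeneous_monomial 1 hm, rfl⟩
    have h1 := hcw _ hmem
    rw [hφ, div_eq_iff (Finsupp.multinomial_cast_ne_zero m), Finset.sum_mul] at h1
    rw [h1]
    refine Finset.sum_congr rfl fun j _ => ?_
    rw [if_pos hm, evalFunction_apply]
    ring
  · simp only [if_neg hm, mul_zero, Finset.sum_const_zero]
    by_contra hne
    exact hm (by rw [Finsupp.degree_eq_weight_one]; exact hf hne)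

end HasWaringDecomposition

lemma IsWaringLimit.hasWaringDecomposition {n d r : ℕ} (hd : 1 ≤ d) {f : MvPolynomial (Fin n) ℂ}
    (hf : f.IsHomogeneous d) (h : IsWaringLimit d r f) :
    HasWaringDecomposition d ((2 * r - 2).choose (r - 1) * d) f := by
  obtain ⟨g, hg, hlim⟩ := h
  choose l hl hgl using fun i => HasWaringDecomposition.of_waringRank_le hd (hg i).2
  choose v hv using fun i k => exists_eq_linearFormOf (hl i k)
  obtain ⟨φ, hφ⟩ := exists_apolar_functional f
  refine .of_isEvalCombination hd hf φ hφ (isEvalCombination_of_tendsto hd v φ fun p hp => ?_)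
  have hmon : ∀ m : Fin n →₀ ℕ, m.degree = d → Tendsto
      (fun i => ∑ k, evalFunction n (monomial m 1) (v i k)) atTop
      (𝓝 (φ (evalFunction n (monomial m 1)))) := by
    intro m hm
    rw [hφ]
    refine ((hlim m).div_const (m.multinomial : ℂ)).congr fun i => ?_
    rw [hgl i, coeff_sum, Finset.sum_div]
    refine Finset.sum_congr rfl fun k _ => ?_
    rw [hv, coeff_linearFormOf_pow, if_pos hm, evalFunction_apply,
      mul_div_cancel_left₀ _ (Finsupp.multinomial_cast_ne_zero m)]
  rw [linearForms_pow_eq_map] at hp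
  obtain ⟨q, hq, rfl⟩ := hp
  have hexp : (evalFunction n).toLinearMap q =
      ∑ m ∈ q.support, coeff m q • evalFunction n (monomial m 1) := by
    conv_lhs => rw [q.as_sum]
    rw [map_sum]
    refine Finset.sum_congr rfl fun m _ => ?_
    rw [← map_smul, smul_monomial, smul_eq_mul, mul_one]
    rfl
  rw [hexp, map_sum]
  have := tendsto_finsetSum q.support fun m hm =>
    (hmon m (by rw [Finsupp.degree_eq_weight_one]; exact hq (mem_support_iff.1 hm))).const_mul
      (coeff m q)
  simp only [map_smul, smul_eq_mul]
  refine this.congr fun i => ?_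
  simp only [Finset.sum_apply, Pi.smul_apply, smul_eq_mul, Finset.mul_sum]
  exact Finset.sum_comm

theorem theorem1 (n d r : ℕ) (hd : 1 ≤ d) (f : MvPolynomial (Fin n) ℂ)
    (hf : f.IsHomogeneous d) (hr : borderWaringRank d f = (r : ℕ∞)) :
    waringRank d f ≤ (((2 * r - 2).choose (r - 1) * d : ℕ) : ℕ∞) ∧
      waringRank d f ≤ ((4 ^ r * d : ℕ) : ℕ∞) := by
  have hlim : IsWaringLimit d r f := by
    by_contra hnot
    have h1 : ((r + 1 : ℕ) : ℕ∞) ≤ borderWaringRank d f := by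
      refine le_iInf₂ fun s hs => ?_
      by_contra! hlt
      -- A limit of forms of rank at most `s ≤ r` is one of forms of rank at most `r`.
      have hsr : s ≤ r := by have := ENat.natCast_lt_natCast.1 hlt; omega
      obtain ⟨g, hg, hgf⟩ := hs
      exact hnot ⟨g, fun i => ⟨(hg i).1, (hg i).2.trans (by exact_mod_cast hsr)⟩, hgf⟩
    rw [hr] at h1
    have := ENat.natCast_le_natCast.1 h1
    omega
  have hmain : waringRank d f ≤ (((2 * r - 2).choose (r - 1) * d : ℕ) : ℕ∞) :=
    iInf₂_le (f := fun s (_ : HasWaringDecomposition d s f) => (s : ℕ∞)) _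
      (hlim.hasWaringDecomposition hd hf)
  refine ⟨hmain, hmain.trans ?_⟩
  have h4 : (2 * r - 2).choose (r - 1) ≤ 4 ^ r :=
    calc (2 * r - 2).choose (r - 1) ≤ 2 ^ (2 * r - 2) := Nat.choose_le_two_pow _ _
      _ ≤ 2 ^ (2 * r) := Nat.pow_le_pow_right (by norm_num) (by omega)
      _ = 4 ^ r := by rw [pow_mul]; norm_num
  exact_mod_cast Nat.mul_le_mul_right d h4
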